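/- Let $H,A,B$ be finite-dimensional complex Hilbert spaces and let $H=(A\otimes B)\oplus K$ be an orthogonal decomposition, i.e. $A\otimes B$ is isometrically embedded in $H$ as a subspace and $K=(A\otimes B)^{\perp}$. Let $P_{AB}$ be the orthogonal projector of $H$ onto $A\otimes B$ and $\mathcal P_{AB}(\sigma)=P_{AB}\,\sigma\,P_{AB}$ for $\sigma\in\mathcal L(H)$. An operation on a finite-dimensional Hilbert space $X$ is a completely positive trace-preserving linear map $\mathcal L(X)\to\mathcal L(X)$. For a linear map $\mathcal F_A$ on $\mathcal L(A)$, regard $\mathcal F_A\otimes\mathrm{id}_B$ as a linear map on $\mathcal L(H)$ that acts on the block $P_{AB}\mathcal L(H)P_{AB}=\mathcal L(A\otimes B)$ and vanishes on the other blocks, i.e. $(\mathcal F_A\otimes\mathrm{id}_B)(\sigma)=(\mathcal F_A\otimes\mathrm{id}_B)(\mathcal P_{AB}(\sigma))$. Let $\mathcal E$ be an operation on $H$ that is unital, $\mathcal E(I)=I$, and let $\mathcal E^{\dagger}$ be its dual, defined by $\mathrm{Tr}(\mathcal E^{\dagger}(\sigma)\tau)=\mathrm{Tr}(\sigma\,\mathcal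 E(\tau))$ for all $\sigma,\tau\in\mathcal L(H)$. Then the following are equivalent. (i) $B$ is a unitarily correctable subsystem for $\mathcal E$: there are a unitary $U\in\mathcal L(H)$, with $\mathcal U(\sigma)=U\sigma U^{\dagger}$, and an operation $\mathcal F_A$ on $A$ such that $\mathcal U\circ\mathcal E\circ\mathcal P_{AB}=\mathcal F_A\otimes\mathrm{id}_B$. (ii) $B$ is a noiseless subsystem for $\mathcal E^{\dagger}\circ\mathcal E$: there is an operation $\mathcal G_A$ on $A$ such that $\mathcal E^{\dagger}\circ\mathcal E\circ\mathcal P_{AB}=\mathcal G_A\otimes\mathrm{id}_B$. -/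

import Mathlib

open scoped TensorProduct CStarAlgebra

set_option linter.unusedSectionVars false

noncomputable section

namespace QSub

/-- A superoperator from `L(H)` to `L(K)`: a linear map between the spaces of operators. -/
abbrev Superop (H K : Type*) [NormedAddCommGroup H] [InnerProductSpace ℂ H]
    [NormedAddCommGroup K] [InnerProductSpace ℂ K] :=
  (H →L[ℂ] H) →ₗ[ℂ] (K →L[ℂ] K)

section General

variable {H K : Type*}
  [NormedAddCommGroup H] [InnerProductSpace ℂ H] [FiniteDimensional ℂ H] [CompleteSpace H]
  [NormedAddCommGroup K] [InnerProductSpace ℂ K] [FiniteDimensional ℂ K] [CompleteSpace K]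

/-- The trace of an operator. -/
def tr : (H →L[ℂ] H) →ₗ[ℂ] ℂ :=
  LinearMap.trace ℂ H ∘ₗ ContinuousLinearMap.coeLM ℂ

/-- A quantum operation (channel): a completely positive, trace-preserving superoperator. -/
structure IsChannel (Φ : Superop H K) : Prop where
  completelyPositive : ∃ φ : (H →L[ℂ] H) →CP (K →L[ℂ] K), φ.toLinearMap = Φ
  trace_preserving : ∀ σ : H →L[ℂ] H, tr (Φ σ) = tr σ

/-- A superoperator is unital if it sends the identity operator to the identity operator. -/
def IsUnital (Φ : Superop H H) : Prop := Φ 1 = 1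

/-- The bilinear form `(σ, τ) ↦ Tr (σ τ)`. -/
def trForm (H : Type*) [NormedAddCommGroup H] [InnerProductSpace ℂ H] :
    LinearMap.BilinForm ℂ (H →L[ℂ] H) :=
  (LinearMap.mul ℂ (H →L[ℂ] H)).compr₂ tr

theorem trForm_apply (σ τ : H →L[ℂ] H) : trForm H σ τ = tr (σ * τ) := rfl

theorem tr_mul_comm (σ τ : H →L[ℂ] H) : tr (σ * τ) = tr (τ * σ) :=
  LinearMap.trace_mul_comm ℂ (σ : H →ₗ[ℂ] H) (τ : H →ₗ[ℂ] H)

theorem tr_mul_rankOne (σ : H →L[ℂ] H) (x y : H) :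
    tr (σ * InnerProductSpace.rankOne ℂ x y) = inner ℂ y (σ x) := by
  rw [ContinuousLinearMap.mul_def, InnerProductSpace.comp_rankOne]
  exact InnerProductSpace.trace_rankOne (σ x) y

theorem trForm_nondegenerate : (trForm H).Nondegenerate := by
  have key : ∀ σ : H →L[ℂ] H, (∀ τ, tr (σ * τ) = 0) → σ = 0 := by
    intro σ h
    ext x
    refine ext_inner_left ℂ fun y => ?_
    rw [← tr_mul_rankOne, h]
    simp
  refine ⟨fun σ h => key σ h, fun σ h => key σ fun τ => ?_⟩
  rw [tr_mul_comm]
  exact h τ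

/-- The dual `E†` of `E`, i.e. the superoperator with `Tr (E†(σ) τ) = Tr (σ E(τ))`
(see `tr_dual` and `eq_dual`). -/
def dual (E : Superop H H) : Superop H H :=
  (trForm H).leftAdjointOfNondegenerate trForm_nondegenerate E

theorem tr_dual (E : Superop H H) (σ τ : H →L[ℂ] H) : tr (dual E σ * τ) = tr (σ * E τ) :=
  (trForm H).isAdjointPairLeftAdjointOfNondegenerate trForm_nondegenerate E σ τ

theorem eq_dual (E F : Superop H H)
    (h : ∀ σ τ : H →L[ℂ] H, tr (F σ * τ) = tr (σ * E τ)) : F = dual E :=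
  ((trForm H).isAdjointPair_iff_eq_of_nondegenerate trForm_nondegenerate F E).1 h

/-- Conjugation `σ ↦ T σ T†` by an operator `T : H → K`. For a unitary `T` on `H` this is the
unitary operation implemented by `T`. -/
def conj (T : H →L[ℂ] K) : Superop H K where
  toFun σ := T ∘L σ ∘L T.adjoint
  map_add' σ τ := by ext; simp
  map_smul' c σ := by ext; simp

end General

section Subsystem

/- The decomposition `H = (A ⊗ B) ⊕ (A ⊗ B)ᗮ` is given by an isometric embedding
`V : A ⊗ B → H`. -/

variable {A B H : Type*}
  [NormedAddCommGroup A] [InnerProductSpace ℂ A] [FiniteDimensional ℂ A] [CompleteSpace A]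
  [NormedAddCommGroup B] [InnerProductSpace ℂ B] [FiniteDimensional ℂ B] [CompleteSpace B]
  [NormedAddCommGroup H] [InnerProductSpace ℂ H] [FiniteDimensional ℂ H] [CompleteSpace H]

instance instCompleteSpaceTensor : CompleteSpace (A ⊗[ℂ] B) := FiniteDimensional.complete ℂ _

/-- The projector `P_AB` onto the subspace `A ⊗ B` of `H`. -/
def projAB (V : A ⊗[ℂ] B →ₗᵢ[ℂ] H) : H →L[ℂ] H :=
  (LinearMap.range V.toLinearMap).starProjection

/-- The superoperator `σ ↦ P_AB σ P_AB`. -/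
def compressAB (V : A ⊗[ℂ] B →ₗᵢ[ℂ] H) : Superop H H where
  toFun σ := projAB V * σ * projAB V
  map_add' σ τ := by simp [mul_add, add_mul]
  map_smul' c σ := by simp

/-- The identification `L(A) ⊗ L(B) = L(A ⊗ B)`, `σ ⊗ τ ↦ mapL σ τ`. -/
def opTensorEquiv (A B : Type*)
    [NormedAddCommGroup A] [InnerProductSpace ℂ A] [FiniteDimensional ℂ A]
    [NormedAddCommGroup B] [InnerProductSpace ℂ B] [FiniteDimensional ℂ B] :
    (A →L[ℂ] A) ⊗[ℂ] (B →L[ℂ] B) ≃ₗ[ℂ] (A ⊗[ℂ] B →L[ℂ] A ⊗[ℂ] B) :=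
  (TensorProduct.congr LinearMap.toContinuousLinearMap.symm
      LinearMap.toContinuousLinearMap.symm) ≪≫ₗ
    homTensorHomEquiv ℂ A B A B ≪≫ₗ LinearMap.toContinuousLinearMap

theorem opTensorEquiv_tmul (σ : A →L[ℂ] A) (τ : B →L[ℂ] B) :
    opTensorEquiv A B (σ ⊗ₜ τ) = TensorProduct.mapL σ τ := by
  ext x
  simp [opTensorEquiv, homTensorHomEquiv_apply]

/-- The tensor product `F ⊗ G` of superoperators on `L(A)` and `L(B)`, as a superoperator on
`L(A ⊗ B)`. -/
def superTensor (F : Superop A A) (G : Superop B B) : Superop (A ⊗[ℂ] B) (A ⊗[ℂ] B) :=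
  (opTensorEquiv A B).toLinearMap ∘ₗ TensorProduct.map F G ∘ₗ (opTensorEquiv A B).symm.toLinearMap

theorem superTensor_mapL (F : Superop A A) (G : Superop B B) (σ : A →L[ℂ] A) (τ : B →L[ℂ] B) :
    superTensor F G (TensorProduct.mapL σ τ) = TensorProduct.mapL (F σ) (G τ) := by
  rw [← opTensorEquiv_tmul σ τ, ← opTensorEquiv_tmul]
  simp [superTensor]

/-- The natural extension of a superoperator on `L(A ⊗ B)` to `L(H)`: it acts on the block
`P_AB L(H) P_AB = L(A ⊗ B)` and vanishes on the other blocks. -/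
def extendAB (V : A ⊗[ℂ] B →ₗᵢ[ℂ] H) (Φ : Superop (A ⊗[ℂ] B) (A ⊗[ℂ] B)) : Superop H H :=
  conj V.toContinuousLinearMap ∘ₗ Φ ∘ₗ conj V.toContinuousLinearMap.adjoint

/-- `B` is a unitarily correctable subsystem for `E`:
`U ∘ E ∘ P_AB = F_A ⊗ id_B` for some unitary operation `U` and some operation `F_A` on `A`. -/
def IsUnitarilyCorrectable (V : A ⊗[ℂ] B →ₗᵢ[ℂ] H) (E : Superop H H) : Prop :=
  ∃ U ∈ unitary (H →L[ℂ] H), ∃ F : Superop A A, IsChannel F ∧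
    conj U ∘ₗ E ∘ₗ compressAB V = extendAB V (superTensor F LinearMap.id)

/-- `B` is a noiseless subsystem for `E`:
`E ∘ P_AB = G_A ⊗ id_B` for some operation `G_A` on `A`. -/
def IsNoiseless (V : A ⊗[ℂ] B →ₗᵢ[ℂ] H) (E : Superop H H) : Prop :=
  ∃ G : Superop A A, IsChannel G ∧
    E ∘ₗ compressAB V = extendAB V (superTensor G LinearMap.id)

end Subsystem

end QSub

end

/-! Work with Kraus operators, write P for the projector onto A ⊗ B, and use that a sum of operators
X X† of trace zero has all X zero. From (i) to (ii): replacing E by U ∘ E leaves E† ∘ E unchanged,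
so E itself may be taken to restrict to F ⊗ id. The compression of E(1 - P) to A ⊗ B is a sum of
squares equal to 1 - F(1) ⊗ 1, of trace zero. Hence F is unital and every Kraus operator preserves
(A ⊗ B)ᗮ (`unital_and_reduced_of_kraus`). The adjoints then preserve A ⊗ B, so E† restricts to F† ⊗
id and G = F† ∘ F works. From (ii) to (i): the same lemma makes G unital, so X_τ = 1 ⊗ τ on the
block is fixed by E† ∘ E. This puts X_τ in the multiplicative domain: K_i X_τ = E(X_τ) K_i
(`comp_eq_of_dual_comp_fixed`). So π(τ) = E(X_τ) is a *-representation of L(B), of multiplicity dim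
A by trace preservation, and an isometry W : A ⊗ B → H carries 1 ⊗ τ to π(τ)
(`exists_isometry_intertwining`). Each W† K_i V commutes with 1 ⊗ L(B), hence is L_i ⊗ 1. A unitary
U with U W = V corrects B, with F given by the L_i. -/

noncomputable section

namespace QSub

open InnerProductSpace ContinuousLinearMap

/-! ### Trace identities and faithfulness of the trace. -/

section Trace

variable {H K : Type*}
  [NormedAddCommGroup H] [InnerProductSpace ℂ H] [FiniteDimensional ℂ H] [CompleteSpace H]
  [NormedAddCommGroup K] [InnerProductSpace ℂ K] [FiniteDimensional ℂ K] [CompleteSpace K]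

theorem tr_comp_comm (S : H →L[ℂ] K) (T : K →L[ℂ] H) : tr (S ∘L T) = tr (T ∘L S) :=
  LinearMap.trace_comp_comm' (T : K →ₗ[ℂ] H) (S : H →ₗ[ℂ] K)

theorem tr_one : tr (1 : H →L[ℂ] H) = Module.finrank ℂ H :=
  LinearMap.trace_one ℂ H

theorem conj_apply (T : H →L[ℂ] K) (σ : H →L[ℂ] H) : conj T σ = T ∘L σ ∘L T.adjoint := rfl

theorem tr_eq_sum_inner (T : H →L[ℂ] H) :
    tr T = ∑ j, inner ℂ (stdOrthonormalBasis ℂ H j) (T (stdOrthonormalBasis ℂ H j)) :=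
  LinearMap.trace_eq_sum_inner (T : H →ₗ[ℂ] H) (stdOrthonormalBasis ℂ H)

theorem tr_comp_adjoint_self (X : H →L[ℂ] K) :
    tr (X ∘L X.adjoint) =
      ((∑ j, ‖X.adjoint (stdOrthonormalBasis ℂ K j)‖ ^ 2 : ℝ) : ℂ) := by
  rw [tr_eq_sum_inner]
  push_cast
  refine Finset.sum_congr rfl fun j _ => ?_
  rw [Function.comp_apply, ← adjoint_inner_left, inner_self_eq_norm_sq_to_K]
  rfl

/-- Faithfulness of the trace on sums of operators of the form `X X†`. -/
theorem eq_zero_of_tr_sum_comp_adjoint {ι : Type*} [Fintype ι] (X : ι → H →L[ℂ] K)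
    (h : tr (∑ i, X i ∘L (X i).adjoint) = 0) (i : ι) : X i = 0 := by
  simp only [map_sum, tr_comp_adjoint_self] at h
  rw [← Complex.ofReal_sum, Complex.ofReal_eq_zero,
    Finset.sum_eq_zero_iff_of_nonneg fun _ _ => Finset.sum_nonneg fun _ _ => sq_nonneg _] at h
  have h1 := h i (Finset.mem_univ i)
  rw [Finset.sum_eq_zero_iff_of_nonneg fun _ _ => sq_nonneg _] at h1
  have h2 : (X i).adjoint = 0 := by
    rw [← ContinuousLinearMap.coe_inj]
    refine (stdOrthonormalBasis ℂ K).toBasis.ext fun j => ?_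
    simpa using h1 j (Finset.mem_univ j)
  rw [← adjoint_adjoint (X i), h2, map_zero]

end Trace

/-- The positive elements of a C⋆-algebra are the elements `star b * b`. -/
theorem nonneg_iff_exists_star_mul_self {R : Type*} [NonUnitalCStarAlgebra R] [PartialOrder R]
    [StarOrderedRing R] {a : R} : 0 ≤ a ↔ ∃ b, a = star b * b :=
  CStarAlgebra.nonneg_iff_eq_star_mul_self

/-! ### Kraus decompositions and complete positivity. -/

section Kraus

variable {H K : Type*}
  [NormedAddCommGroup H] [InnerProductSpace ℂ H] [FiniteDimensional ℂ H] [CompleteSpace H]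
  [NormedAddCommGroup K] [InnerProductSpace ℂ K] [FiniteDimensional ℂ K] [CompleteSpace K]

/-- The superoperator `σ ↦ ∑ i, L i σ (L i)†` with Kraus operators `L i`. -/
def kraus {ι : Type*} [Fintype ι] (L : ι → H →L[ℂ] K) : Superop H K := ∑ i, conj (L i)

theorem kraus_apply {ι : Type*} [Fintype ι] (L : ι → H →L[ℂ] K) (σ : H →L[ℂ] H) :
    kraus L σ = ∑ i, L i ∘L σ ∘L (L i).adjoint := by
  simp [kraus, conj_apply]

theorem eq_sum_inner_smul_rankOne (σ : H →L[ℂ] H) :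
    σ = ∑ i, ∑ j, inner ℂ (stdOrthonormalBasis ℂ H i) (σ (stdOrthonormalBasis ℂ H j)) •
      rankOne ℂ (stdOrthonormalBasis ℂ H i) (stdOrthonormalBasis ℂ H j) := by
  rw [← ContinuousLinearMap.coe_inj]
  refine (stdOrthonormalBasis ℂ H).toBasis.ext fun k => ?_
  simp [OrthonormalBasis.inner_eq_ite, OrthonormalBasis.sum_repr']

theorem superop_ext {Φ Ψ : Superop H K}
    (h : ∀ i j, Φ (rankOne ℂ (stdOrthonormalBasis ℂ H i) (stdOrthonormalBasis ℂ H j)) =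
      Ψ (rankOne ℂ (stdOrthonormalBasis ℂ H i) (stdOrthonormalBasis ℂ H j))) : Φ = Ψ := by
  ext1 σ
  rw [eq_sum_inner_smul_rankOne σ]
  simp only [map_sum, map_smul, h]

/-- The Choi matrix of the identity superoperator is positive. -/
theorem choi_nonneg :
    0 ≤ CStarMatrix.ofMatrix (Matrix.of fun i j : Fin (Module.finrank ℂ H) =>
      (rankOne ℂ (stdOrthonormalBasis ℂ H i) (stdOrthonormalBasis ℂ H j) : H →L[ℂ] H)) := by
  rcases Nat.eq_zero_or_pos (Module.finrank ℂ H) with h0 | h0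
  · refine le_of_eq (CStarMatrix.ext fun i => ?_)
    exact absurd i.2 (by omega)
  rw [nonneg_iff_exists_star_mul_self]
  -- A square root with one nonzero row, with entries |e_0⟩⟨e_j|: indeed (|e_0⟩⟨e_i|)† |e_0⟩⟨e_j| =
  -- |e_i⟩⟨e_j|. Row 0 exists only in positive dimension, hence the case split.
  refine ⟨CStarMatrix.ofMatrix (Matrix.of fun k j : Fin (Module.finrank ℂ H) =>
    if k = ⟨0, h0⟩ then
      (rankOne ℂ (stdOrthonormalBasis ℂ H k) (stdOrthonormalBasis ℂ H j) : H →L[ℂ] H) else 0), ?_⟩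
  refine CStarMatrix.ext fun i j => ?_
  rw [CStarMatrix.mul_apply, Finset.sum_eq_single ⟨0, h0⟩]
  · simp [CStarMatrix.star_apply, star_eq_adjoint, mul_def, rankOne_comp_rankOne]
  · intro k _ hk
    simp [hk]
  · simp

/-- **Choi's theorem**: a completely positive superoperator has a Kraus decomposition. -/
theorem exists_kraus (φ : (H →L[ℂ] H) →CP (K →L[ℂ] K)) :
    ∃ (ι : Type) (_ : Fintype ι) (L : ι → H →L[ℂ] K), φ.toLinearMap = kraus L := by
  have h := φ.map_cstarMatrix_nonneg' _ _ (choi_nonneg (H := H))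
  rw [nonneg_iff_exists_star_mul_self] at h
  obtain ⟨Z, hZ⟩ := h
  have hZ' : ∀ i j, φ.toLinearMap
      (rankOne ℂ (stdOrthonormalBasis ℂ H i) (stdOrthonormalBasis ℂ H j)) =
      ∑ k, (Z k i).adjoint ∘L Z k j := by
    intro i j
    have := congrFun (congrFun hZ i) j
    rw [CStarMatrix.mul_apply] at this
    simpa [CStarMatrix.star_apply, star_eq_adjoint, mul_def] using! this
  -- The operator L_{k,m} sends e_i to Z_{ki}† f_m, with f the basis of `K`. Summing L_{k,m}
  -- |e_i⟩⟨e_j| L_{k,m}† over m gives Z_{ki}† Z_{kj}, by the resolution of the identity in f.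
  refine ⟨Fin (Module.finrank ℂ H) × Fin (Module.finrank ℂ K), inferInstance, fun p =>
    ∑ i, rankOne ℂ ((Z p.1 i).adjoint (stdOrthonormalBasis ℂ K p.2)) (stdOrthonormalBasis ℂ H i),
    superop_ext fun i j => ?_⟩
  rw [hZ', kraus_apply, Fintype.sum_prod_type]
  refine Finset.sum_congr rfl fun k _ => ?_
  have hL : ∀ (m : Fin (Module.finrank ℂ K)) (a : Fin (Module.finrank ℂ H)),
      (∑ i, rankOne ℂ ((Z k i).adjoint (stdOrthonormalBasis ℂ K m))
        (stdOrthonormalBasis ℂ H i)) (stdOrthonormalBasis ℂ H a) =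
        (Z k a).adjoint (stdOrthonormalBasis ℂ K m) := by
    intro m a
    simp [sum_apply, OrthonormalBasis.inner_eq_ite]
  have hc : ∀ L : H →L[ℂ] K, L ∘L (rankOne ℂ (stdOrthonormalBasis ℂ H i)
        (stdOrthonormalBasis ℂ H j)) ∘L L.adjoint =
      rankOne ℂ (L (stdOrthonormalBasis ℂ H i)) (L (stdOrthonormalBasis ℂ H j)) := by
    intro L
    rw [rankOne_comp, comp_rankOne, adjoint_adjoint]
  conv_lhs => rw [← id_comp (Z k j), ← (stdOrthonormalBasis ℂ K).sum_rankOne_eq_id]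
  rw [finsetSum_comp, comp_finsetSum]
  refine Finset.sum_congr rfl fun m _ => ?_
  rw [hc, hL, hL, rankOne_comp, comp_rankOne]

/-- A superoperator with a Kraus decomposition is completely positive. -/
theorem exists_completelyPositive_of_kraus {ι : Type*} [Fintype ι] (L : ι → H →L[ℂ] H) :
    ∃ φ : (H →L[ℂ] H) →CP (H →L[ℂ] H), φ.toLinearMap = kraus L := by
  refine ⟨⟨kraus L, fun k M hM => ?_⟩, rfl⟩
  rw [nonneg_iff_exists_star_mul_self] at hM
  obtain ⟨Z, rfl⟩ := hM
  -- Since L z† z' L† = (z L†)† (z' L†), each Kraus term of the amplified map is again a square.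
  have : (star Z * Z).map (kraus L) =
      ∑ i, star ((Z.map fun z => z ∘L (L i).adjoint)) * Z.map fun z => z ∘L (L i).adjoint := by
    refine CStarMatrix.ext fun a b => ?_
    have hs : ∀ F : ι → CStarMatrix (Fin k) (Fin k) (H →L[ℂ] H),
        (∑ i, F i) a b = ∑ i, F i a b := fun F => by
      exact Matrix.sum_apply a b Finset.univ F
    rw [hs, CStarMatrix.map_apply, CStarMatrix.mul_apply, map_sum]
    simp only [CStarMatrix.mul_apply, kraus_apply]
    rw [Finset.sum_comm]
    refine Finset.sum_congr rfl fun i _ => Finset.sum_congr rfl fun l _ => ?_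
    simp [CStarMatrix.star_apply, star_eq_adjoint, mul_def, adjoint_comp, comp_assoc]
  change 0 ≤ (star Z * Z).map (kraus L)
  rw [this]
  exact Finset.sum_nonneg fun i _ => star_mul_self_nonneg _

theorem tr_kraus {ι : Type*} [Fintype ι] (L : ι → H →L[ℂ] K) (σ : H →L[ℂ] H) :
    tr (kraus L σ) = tr ((∑ i, (L i).adjoint ∘L L i) * σ) := by
  rw [kraus_apply, Finset.sum_mul, map_sum, map_sum]
  refine Finset.sum_congr rfl fun i _ => ?_
  rw [tr_comp_comm, mul_def, comp_assoc, tr_comp_comm, comp_assoc]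

theorem kraus_trace_preserving_iff {ι : Type*} [Fintype ι] (L : ι → H →L[ℂ] K) :
    (∀ σ, tr (kraus L σ) = tr σ) ↔ ∑ i, (L i).adjoint ∘L L i = 1 := by
  constructor
  · intro h
    rw [← sub_eq_zero]
    refine trForm_nondegenerate.1 _ fun σ => ?_
    rw [trForm_apply, sub_mul, one_mul, map_sub, ← tr_kraus, h, sub_self]
  · intro h σ
    rw [tr_kraus, h, one_mul]

theorem isChannel_kraus {ι : Type*} [Fintype ι] {L : ι → H →L[ℂ] H}
    (h : ∑ i, (L i).adjoint ∘L L i = 1) : IsChannel (kraus L) :=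
  ⟨exists_completelyPositive_of_kraus L, (kraus_trace_preserving_iff L).2 h⟩

theorem IsChannel.exists_kraus {Φ : Superop H K} (h : IsChannel Φ) :
    ∃ (ι : Type) (_ : Fintype ι) (L : ι → H →L[ℂ] K),
      Φ = kraus L ∧ ∑ i, (L i).adjoint ∘L L i = 1 := by
  obtain ⟨φ, hφ⟩ := h.completelyPositive
  obtain ⟨ι, _, L, hL⟩ := QSub.exists_kraus φ
  have hΦ : Φ = kraus L := hφ ▸ hL
  exact ⟨ι, inferInstance, L, hΦ, (kraus_trace_preserving_iff L).1 (hΦ ▸ h.trace_preserving)⟩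

theorem dual_kraus {ι : Type*} [Fintype ι] (L : ι → H →L[ℂ] H) :
    dual (kraus L) = kraus fun i => (L i).adjoint := by
  refine (eq_dual _ _ fun σ τ => ?_).symm
  rw [kraus_apply, kraus_apply, Finset.sum_mul, Finset.mul_sum, map_sum, map_sum]
  refine Finset.sum_congr rfl fun i _ => ?_
  simp only [mul_def, adjoint_adjoint, comp_assoc]
  rw [tr_comp_comm]
  simp only [comp_assoc]

theorem kraus_comp_kraus {ι κ : Type*} [Fintype ι] [Fintype κ] (L : ι → H →L[ℂ] H)
    (M : κ → H →L[ℂ] H) :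
    kraus L ∘ₗ kraus M = kraus fun p : ι × κ => L p.1 ∘L M p.2 := by
  ext1 σ
  simp only [LinearMap.comp_apply, kraus_apply, Fintype.sum_prod_type, finsetSum_comp,
    comp_finsetSum, adjoint_comp, comp_assoc]

theorem isChannel_id : IsChannel (LinearMap.id : Superop H H) := by
  have : (LinearMap.id : Superop H H) = kraus fun _ : Unit => (1 : H →L[ℂ] H) := by
    ext1 σ
    simp [kraus_apply, ← star_eq_adjoint, ← mul_def]
  rw [this]
  exact isChannel_kraus (by simp [← star_eq_adjoint, ← mul_def])

end Kraus

/-! ### Superoperators of the form F ⊗ id. -/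

section Amplification

variable {A B H : Type*}
  [NormedAddCommGroup A] [InnerProductSpace ℂ A] [FiniteDimensional ℂ A] [CompleteSpace A]
  [NormedAddCommGroup B] [InnerProductSpace ℂ B] [FiniteDimensional ℂ B] [CompleteSpace B]
  [NormedAddCommGroup H] [InnerProductSpace ℂ H] [FiniteDimensional ℂ H] [CompleteSpace H]

theorem adjoint_one : (1 : H →L[ℂ] H).adjoint = 1 := by
  rw [← star_eq_adjoint, star_one]

theorem mapL_one_one :
    TensorProduct.mapL (1 : A →L[ℂ] A) (1 : B →L[ℂ] B) = 1 := TensorProduct.mapL_id_id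

theorem tr_mapL (σ : A →L[ℂ] A) (τ : B →L[ℂ] B) :
    tr (TensorProduct.mapL σ τ) = tr σ * tr τ := by
  change LinearMap.trace ℂ _ (TensorProduct.mapL σ τ).toLinearMap = _
  rw [TensorProduct.toLinearMap_mapL, LinearMap.trace_tensorProduct']
  rfl

/-- Superoperators on `L(A ⊗ B)` agreeing on elementary tensors are equal. -/
theorem superop_tensor_ext {Φ Ψ : Superop (A ⊗[ℂ] B) H}
    (h : ∀ σ τ, Φ (TensorProduct.mapL σ τ) = Ψ (TensorProduct.mapL σ τ)) : Φ = Ψ := by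
  have : Φ ∘ₗ (opTensorEquiv A B).toLinearMap = Ψ ∘ₗ (opTensorEquiv A B).toLinearMap := by
    refine TensorProduct.ext' fun σ τ => ?_
    simpa [opTensorEquiv_tmul] using h σ τ
  ext1 σ
  simpa using LinearMap.congr_fun this ((opTensorEquiv A B).symm σ)

theorem superTensor_kraus_id {ι : Type*} [Fintype ι] (L : ι → A →L[ℂ] A) :
    superTensor (kraus L) (LinearMap.id : Superop B B) =
      kraus fun i => TensorProduct.mapL (L i) (1 : B →L[ℂ] B) := by
  refine superop_tensor_ext fun σ τ => ?_
  rw [superTensor_mapL, kraus_apply, kraus_apply]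
  have : ∀ i, TensorProduct.mapL (L i) (1 : B →L[ℂ] B) ∘L TensorProduct.mapL σ τ ∘L
      (TensorProduct.mapL (L i) (1 : B →L[ℂ] B)).adjoint =
      TensorProduct.mapL (L i ∘L σ ∘L (L i).adjoint) τ := by
    intro i
    rw [TensorProduct.adjoint_mapL, adjoint_one, ← TensorProduct.mapL_comp,
      ← TensorProduct.mapL_comp]
    rfl
  simp only [this, LinearMap.id_apply]
  refine Eq.symm (ContinuousLinearMap.ext fun x => ?_)
  induction x with
  | zero => simp
  | add x y hx hy => rw [map_add, map_add, hx, hy]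
  | tmul a b => simp [sum_apply, TensorProduct.sum_tmul]

theorem superTensor_comp_id (F G : Superop A A) :
    superTensor (F ∘ₗ G) (LinearMap.id : Superop B B) =
      superTensor F LinearMap.id ∘ₗ superTensor G LinearMap.id := by
  refine superop_tensor_ext fun σ τ => ?_
  simp [superTensor_mapL]

/-- A unit vector b of `B` recovers the matrix coefficients of σ from those of σ ⊗ 1 at vectors a ⊗
b. -/
theorem mapL_one_right_injective [Nontrivial B] {σ τ : A →L[ℂ] A}
    (h : TensorProduct.mapL σ (1 : B →L[ℂ] B) = TensorProduct.mapL τ 1) : σ = τ := by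
  obtain ⟨b, hb⟩ := exists_norm_eq B zero_le_one
  refine ContinuousLinearMap.ext fun a => ext_inner_left ℂ fun a' => ?_
  have := congrArg (fun T => inner ℂ (a' ⊗ₜ[ℂ] b) (T (a ⊗ₜ[ℂ] b))) h
  simpa [inner_self_eq_norm_sq_to_K, hb] using this

end Amplification

/-! ### The block A ⊗ B inside H. -/

section Embedding

variable {A B H : Type*}
  [NormedAddCommGroup A] [InnerProductSpace ℂ A] [FiniteDimensional ℂ A] [CompleteSpace A]
  [NormedAddCommGroup B] [InnerProductSpace ℂ B] [FiniteDimensional ℂ B] [CompleteSpace B]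
  [NormedAddCommGroup H] [InnerProductSpace ℂ H] [FiniteDimensional ℂ H] [CompleteSpace H]

theorem adjoint_comp_isometry {X : Type*} [NormedAddCommGroup X] [InnerProductSpace ℂ X]
    [CompleteSpace X] (V : X →ₗᵢ[ℂ] H) :
    V.toContinuousLinearMap.adjoint ∘L V.toContinuousLinearMap = 1 := by
  refine ContinuousLinearMap.ext fun x => ext_inner_left ℂ fun y => ?_
  rw [ContinuousLinearMap.comp_apply, adjoint_inner_right]
  exact V.inner_map_map y x

theorem projAB_eq (V : A ⊗[ℂ] B →ₗᵢ[ℂ] H) :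
    projAB V = V.toContinuousLinearMap ∘L V.toContinuousLinearMap.adjoint := by
  refine ContinuousLinearMap.ext fun x => ?_
  refine Submodule.eq_starProjection_of_mem_of_inner_eq_zero ⟨_, rfl⟩ ?_
  rintro _ ⟨y, rfl⟩
  have h := congrArg (fun T => T (V.toContinuousLinearMap.adjoint x)) (adjoint_comp_isometry V)
  change inner ℂ (x - V.toContinuousLinearMap (V.toContinuousLinearMap.adjoint x))
    (V.toContinuousLinearMap y) = 0
  rw [← adjoint_inner_left, map_sub]
  simp only [ContinuousLinearMap.comp_apply, one_apply_eq_self] at h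
  rw [h, sub_self, inner_zero_left]

theorem compressAB_apply (V : A ⊗[ℂ] B →ₗᵢ[ℂ] H) (σ : H →L[ℂ] H) :
    compressAB V σ = V.toContinuousLinearMap ∘L
      (V.toContinuousLinearMap.adjoint ∘L σ ∘L V.toContinuousLinearMap) ∘L
        V.toContinuousLinearMap.adjoint := by
  change projAB V * σ * projAB V = _
  rw [projAB_eq]
  rfl

theorem extendAB_apply (V : A ⊗[ℂ] B →ₗᵢ[ℂ] H) (Φ : Superop (A ⊗[ℂ] B) (A ⊗[ℂ] B))
    (σ : H →L[ℂ] H) :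
    extendAB V Φ σ = V.toContinuousLinearMap ∘L
      Φ (V.toContinuousLinearMap.adjoint ∘L σ ∘L V.toContinuousLinearMap) ∘L
        V.toContinuousLinearMap.adjoint := by
  simp [extendAB, conj_apply]

theorem adjoint_comp_conj_comp {X : Type*} [NormedAddCommGroup X] [InnerProductSpace ℂ X]
    [CompleteSpace X] (V : X →ₗᵢ[ℂ] H) (ρ : X →L[ℂ] X) :
    V.toContinuousLinearMap.adjoint ∘L
      (V.toContinuousLinearMap ∘L ρ ∘L V.toContinuousLinearMap.adjoint) ∘L
        V.toContinuousLinearMap = ρ := by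
  have h : ∀ x, V.toContinuousLinearMap.adjoint (V.toContinuousLinearMap x) = x := fun x =>
    congrArg (fun T => T x) (adjoint_comp_isometry V)
  refine ContinuousLinearMap.ext fun x => ?_
  simp only [ContinuousLinearMap.comp_apply, h]

/-- Both sides see σ only through its compression V† σ V, which can be any operator ρ. This removes
the projectors from both definitions. -/
theorem comp_compressAB_eq_extendAB_iff (V : A ⊗[ℂ] B →ₗᵢ[ℂ] H) (Ψ : Superop H H)
    (Φ : Superop (A ⊗[ℂ] B) (A ⊗[ℂ] B)) :
    Ψ ∘ₗ compressAB V = extendAB V Φ ↔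
      ∀ ρ, Ψ (V.toContinuousLinearMap ∘L ρ ∘L V.toContinuousLinearMap.adjoint) =
        V.toContinuousLinearMap ∘L Φ ρ ∘L V.toContinuousLinearMap.adjoint := by
  constructor
  · intro h ρ
    have := LinearMap.congr_fun h (V.toContinuousLinearMap ∘L ρ ∘L V.toContinuousLinearMap.adjoint)
    rw [LinearMap.comp_apply, compressAB_apply, extendAB_apply, adjoint_comp_conj_comp] at this
    exact this
  · intro h
    ext1 σ
    rw [LinearMap.comp_apply, compressAB_apply, extendAB_apply, h]

/-- If a unital map with Kraus operators `M i` restricts to `F ⊗ id` on the block `L(A ⊗ B)`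
with `F` trace preserving, then `F` is unital and each `M i` maps `(A ⊗ B)ᗮ` to itself. -/
theorem unital_and_reduced_of_kraus [Nontrivial B] (V : A ⊗[ℂ] B →ₗᵢ[ℂ] H) {ι : Type*} [Fintype ι]
    (M : ι → H →L[ℂ] H) (hM : kraus M 1 = 1) (F : Superop A A)
    (hF : ∀ σ, tr (F σ) = tr σ)
    (h : ∀ ρ, kraus M (V.toContinuousLinearMap ∘L ρ ∘L V.toContinuousLinearMap.adjoint) =
      V.toContinuousLinearMap ∘L superTensor F LinearMap.id ρ ∘L V.toContinuousLinearMap.adjoint) :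
    F 1 = 1 ∧ ∀ i, V.toContinuousLinearMap.adjoint ∘L M i =
      V.toContinuousLinearMap.adjoint ∘L M i ∘L V.toContinuousLinearMap ∘L
        V.toContinuousLinearMap.adjoint := by
  set v := V.toContinuousLinearMap with hv
  have hvv : v.adjoint ∘L v = 1 := adjoint_comp_isometry V
  have hvx : ∀ x, v.adjoint (v x) = x := fun x => congrArg (fun T => T x) hvv
  have hP : kraus M (v ∘L v.adjoint) =
      v ∘L TensorProduct.mapL (F 1) (1 : B →L[ℂ] B) ∘L v.adjoint := by
    have := h 1
    rw [← mapL_one_one, superTensor_mapL, mapL_one_one] at this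
    exact this
  -- The projector onto (A ⊗ B)ᗮ. Unitality turns the image of q into 1 minus the image of the block
  -- projector.
  let q : H →L[ℂ] H := 1 - v ∘L v.adjoint
  have hq : q ∘L q.adjoint = q := by
    have hqa : q.adjoint = q := by
      simp only [q, map_sub, adjoint_one, adjoint_comp, adjoint_adjoint]
    rw [hqa]
    refine ContinuousLinearMap.ext fun x => ?_
    simp [q, hvx]
  have hsum : ∑ i, (v.adjoint ∘L M i ∘L q) ∘L (v.adjoint ∘L M i ∘L q).adjoint =
      1 - TensorProduct.mapL (F 1) (1 : B →L[ℂ] B) := by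
    have e1 : v.adjoint ∘L kraus M q ∘L v = 1 - TensorProduct.mapL (F 1) (1 : B →L[ℂ] B) := by
      rw [map_sub, hM, hP]
      refine ContinuousLinearMap.ext fun x => ?_
      simp [hvx]
    rw [← e1, kraus_apply, finsetSum_comp, comp_finsetSum]
    refine Finset.sum_congr rfl fun i _ => ?_
    conv_rhs => rw [← hq]
    simp only [adjoint_comp, adjoint_adjoint, comp_assoc]
  have htr : tr (1 - TensorProduct.mapL (F 1) (1 : B →L[ℂ] B)) = 0 := by
    rw [map_sub, tr_mapL, hF, ← tr_mapL, mapL_one_one, sub_self]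
  have hzero := eq_zero_of_tr_sum_comp_adjoint (fun i => v.adjoint ∘L M i ∘L q)
    (by rw [hsum, htr])
  refine ⟨?_, fun i => ?_⟩
  · refine mapL_one_right_injective (B := B) ?_
    rw [mapL_one_one]
    rw [Finset.sum_eq_zero fun i _ => by rw [hzero i, zero_comp]] at hsum
    exact (sub_eq_zero.1 hsum.symm).symm
  · refine ContinuousLinearMap.ext fun x => ?_
    have := congrArg (fun T => T x) (hzero i)
    simpa [q, sub_eq_zero] using this

/-- For `B` = 0 the block is zero and both properties hold trivially. This case is split off because
L ⊗ 1 determines L only when `B` is nonzero. -/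
theorem toContinuousLinearMap_eq_zero_of_subsingleton [Subsingleton B]
    (V : A ⊗[ℂ] B →ₗᵢ[ℂ] H) : V.toContinuousLinearMap = 0 := by
  rw [← ContinuousLinearMap.coe_inj]
  refine TensorProduct.ext' fun a b => ?_
  rw [Subsingleton.elim b 0, TensorProduct.tmul_zero, map_zero, map_zero]

theorem isUnitarilyCorrectable_of_subsingleton [Subsingleton B] (V : A ⊗[ℂ] B →ₗᵢ[ℂ] H)
    (E : Superop H H) : IsUnitarilyCorrectable V E := by
  refine ⟨1, one_mem _, LinearMap.id, isChannel_id, ?_⟩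
  rw [← LinearMap.comp_assoc, comp_compressAB_eq_extendAB_iff]
  simp [toContinuousLinearMap_eq_zero_of_subsingleton]

theorem isNoiseless_of_subsingleton [Subsingleton B] (V : A ⊗[ℂ] B →ₗᵢ[ℂ] H)
    (E : Superop H H) : IsNoiseless V E := by
  refine ⟨LinearMap.id, isChannel_id, ?_⟩
  rw [comp_compressAB_eq_extendAB_iff]
  simp [toContinuousLinearMap_eq_zero_of_subsingleton]

/-! ### Unitarily correctable implies noiseless. -/

theorem dual_comp_self_conj_unitary {U : H →L[ℂ] H} (hU : U ∈ unitary (H →L[ℂ] H))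
    (E : Superop H H) : dual (conj U ∘ₗ E) ∘ₗ (conj U ∘ₗ E) = dual E ∘ₗ E := by
  ext1 σ
  rw [← sub_eq_zero]
  refine trForm_nondegenerate.1 _ fun τ => ?_
  have hU' : U.adjoint ∘L U = 1 := (Unitary.mem_iff.1 hU).1
  have : (conj U (E σ)) * (conj U (E τ)) = U ∘L ((E σ * E τ) ∘L U.adjoint) := by
    simp only [conj_apply, mul_def, comp_assoc]
    rw [← comp_assoc U.adjoint U, hU', one_def, id_comp]
  rw [trForm_apply, sub_mul, map_sub]
  simp only [LinearMap.comp_apply, tr_dual]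
  rw [this, tr_comp_comm, comp_assoc, hU', one_def, comp_id, sub_self]

theorem IsUnitarilyCorrectable.isNoiseless_dual_comp (V : A ⊗[ℂ] B →ₗᵢ[ℂ] H) {E : Superop H H}
    (hE : IsChannel E) (hE1 : IsUnital E) (hV : IsUnitarilyCorrectable V E) :
    IsNoiseless V (dual E ∘ₗ E) := by
  rcases subsingleton_or_nontrivial B with _ | _
  · exact isNoiseless_of_subsingleton V _
  obtain ⟨U, hU, F, hF, h⟩ := hV
  obtain ⟨ι, _, K, rfl, -⟩ := hE.exists_kraus
  obtain ⟨κ, _, L, rfl, hL⟩ := hF.exists_kraus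
  have hUE : conj U ∘ₗ kraus K = kraus fun i => U ∘L K i := by
    ext1 σ
    simp only [LinearMap.comp_apply, kraus_apply, conj_apply, comp_finsetSum, finsetSum_comp,
      adjoint_comp, comp_assoc]
  rw [← dual_comp_self_conj_unitary hU, hUE]
  rw [← LinearMap.comp_assoc, hUE, comp_compressAB_eq_extendAB_iff] at h
  set M : ι → H →L[ℂ] H := fun i => U ∘L K i
  have hM : kraus M 1 = 1 := by
    rw [← hUE, LinearMap.comp_apply, hE1, conj_apply]
    exact (Unitary.mem_iff.1 hU).2
  obtain ⟨hF1, hred⟩ := unital_and_reduced_of_kraus V M hM _ hF.trace_preserving h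
  set v := V.toContinuousLinearMap with hv
  let R : ι → A ⊗[ℂ] B →L[ℂ] A ⊗[ℂ] B := fun i => v.adjoint ∘L M i ∘L v
  have hR : kraus R = superTensor (kraus L) LinearMap.id := by
    ext1 ρ
    rw [← adjoint_comp_conj_comp V (superTensor _ _ ρ), ← hv, ← h, kraus_apply, kraus_apply,
      finsetSum_comp, comp_finsetSum]
    simp only [R, adjoint_comp, adjoint_adjoint, comp_assoc]
  -- The families `R` and L ⊗ 1 are Kraus families of one map but need not agree termwise. Taking
  -- the dual of that map avoids comparing them.
  have hRd : kraus (fun i => (R i).adjoint) =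
      superTensor (kraus fun i => (L i).adjoint) (LinearMap.id : Superop B B) := by
    rw [← dual_kraus, hR, superTensor_kraus_id, dual_kraus, superTensor_kraus_id]
    simp only [TensorProduct.adjoint_mapL, adjoint_one]
  have hMd : ∀ ρ, dual (kraus M) (v ∘L ρ ∘L v.adjoint) =
      v ∘L superTensor (kraus fun i => (L i).adjoint) LinearMap.id ρ ∘L v.adjoint := by
    intro ρ
    rw [← hRd, dual_kraus, kraus_apply, kraus_apply, finsetSum_comp, comp_finsetSum]
    refine Finset.sum_congr rfl fun i _ => ?_
    -- Adjoint form of `hred`: since M_i preserves (A ⊗ B)ᗮ, its adjoint preserves A ⊗ B.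
    have h1 : (M i).adjoint ∘L v = v ∘L v.adjoint ∘L (M i).adjoint ∘L v := by
      have := congrArg adjoint (hred i)
      simpa only [adjoint_comp, adjoint_adjoint, comp_assoc] using this
    simp only [R, adjoint_comp, adjoint_adjoint]
    refine ContinuousLinearMap.ext fun x => ?_
    have h2 : v.adjoint (M i x) = v.adjoint (M i (v (v.adjoint x))) :=
      congrArg (fun T => T x) (hred i)
    simp only [ContinuousLinearMap.comp_apply]
    rw [h2]
    exact congrArg (fun T => T (ρ (v.adjoint (M i (v (v.adjoint x)))))) h1
  -- The witness is F† ∘ F; here F† preserves the trace because F is unital.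
  refine ⟨kraus (fun i => (L i).adjoint) ∘ₗ kraus L, ⟨?_, fun σ => ?_⟩, ?_⟩
  · rw [kraus_comp_kraus]
    exact exists_completelyPositive_of_kraus _
  · rw [LinearMap.comp_apply, ← (kraus_trace_preserving_iff L).2 hL σ]
    refine (kraus_trace_preserving_iff _).2 ?_ _
    rw [← hF1, kraus_apply]
    simp only [adjoint_adjoint, one_def, id_comp]
  · rw [comp_compressAB_eq_extendAB_iff]
    intro ρ
    rw [LinearMap.comp_apply, h, hMd, superTensor_comp_id, LinearMap.comp_apply]

end Embedding

/-! ### Multiplicative domain and representations of L(B). -/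

section Representation

theorem clm_one_comp {X Y : Type*} [NormedAddCommGroup X] [InnerProductSpace ℂ X]
    [NormedAddCommGroup Y] [InnerProductSpace ℂ Y] (T : X →L[ℂ] Y) : (1 : Y →L[ℂ] Y) ∘L T = T :=
  id_comp T

theorem clm_comp_one {X Y : Type*} [NormedAddCommGroup X] [InnerProductSpace ℂ X]
    [NormedAddCommGroup Y] [InnerProductSpace ℂ Y] (T : X →L[ℂ] Y) : T ∘L (1 : X →L[ℂ] X) = T :=
  comp_id T

variable {A B H : Type*}
  [NormedAddCommGroup A] [InnerProductSpace ℂ A] [FiniteDimensional ℂ A] [CompleteSpace A]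
  [NormedAddCommGroup B] [InnerProductSpace ℂ B] [FiniteDimensional ℂ B] [CompleteSpace B]
  [NormedAddCommGroup H] [InnerProductSpace ℂ H] [FiniteDimensional ℂ H] [CompleteSpace H]

theorem adjoint_kraus {ι : Type*} [Fintype ι] (K : ι → H →L[ℂ] H) (σ : H →L[ℂ] H) :
    (kraus K σ).adjoint = kraus K σ.adjoint := by
  simp only [kraus_apply, map_sum, adjoint_comp, adjoint_adjoint, comp_assoc]

/-- A fixed point of `E† ∘ E` lies in the multiplicative domain of the unital channel `E`. -/
theorem comp_eq_of_dual_comp_fixed {ι : Type*} [Fintype ι] (K : ι → H →L[ℂ] H)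
    (h1 : kraus K 1 = 1) (htr : ∀ σ, tr (kraus K σ) = tr σ) (X : H →L[ℂ] H)
    (hX : dual (kraus K) (kraus K X) = X) (i : ι) : K i ∘L X = kraus K X ∘L K i := by
  -- Equality in the Schwarz inequality under the trace: the squares sum to E(X X†) - E(X) E(X)†,
  -- whose trace is Tr(X X†) - Tr(E†(E(X)) X†) = 0.
  refine sub_eq_zero.1 (eq_zero_of_tr_sum_comp_adjoint
    (fun i => K i ∘L X - kraus K X ∘L K i) ?_ i)
  have hterm : ∀ (Y : H →L[ℂ] H) (i : ι), (K i ∘L X - Y ∘L K i) ∘L (K i ∘L X - Y ∘L K i).adjoint =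
      K i ∘L (X * X.adjoint) ∘L (K i).adjoint - (K i ∘L X ∘L (K i).adjoint) * Y.adjoint
        - Y * (K i ∘L X.adjoint ∘L (K i).adjoint) +
        Y * (K i ∘L 1 ∘L (K i).adjoint) * Y.adjoint := by
    intro Y i
    rw [map_sub, adjoint_comp, adjoint_comp]
    simp only [← mul_def]
    noncomm_ring
  have hsum : ∀ Y : H →L[ℂ] H, ∑ i, (K i ∘L X - Y ∘L K i) ∘L (K i ∘L X - Y ∘L K i).adjoint =
      kraus K (X * X.adjoint) - kraus K X * Y.adjoint - Y * kraus K X.adjoint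
        + Y * kraus K 1 * Y.adjoint := by
    intro Y
    simp only [hterm, kraus_apply, Finset.sum_add_distrib, Finset.sum_sub_distrib, Finset.sum_mul,
      Finset.mul_sum]
  rw [hsum, h1, mul_one, adjoint_kraus, sub_add_cancel, map_sub, htr, ← tr_dual, hX, sub_self]

/-- Two isometries of `X` into `H` differ by a unitary. -/
theorem exists_unitary_comp_eq {X : Type*} [NormedAddCommGroup X] [InnerProductSpace ℂ X]
    [CompleteSpace X] (V W : X →ₗᵢ[ℂ] H) :
    ∃ U ∈ unitary (H →L[ℂ] H), U ∘L W.toContinuousLinearMap = V.toContinuousLinearMap := by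
  -- The map W x ↦ V x extends to an isometry of `H`, which is unitary by finite dimensionality.
  let L : LinearMap.range W.toLinearMap →ₗᵢ[ℂ] H := V.comp W.equivRange.symm.toLinearIsometry
  have hU : L.extend.toContinuousLinearMap.adjoint ∘L L.extend.toContinuousLinearMap = 1 :=
    adjoint_comp_isometry L.extend
  refine ⟨L.extend.toContinuousLinearMap, Unitary.mem_iff.2 ⟨hU, ?_⟩, ?_⟩
  · have h := congrArg ContinuousLinearMap.toLinearMap hU
    rw [← ContinuousLinearMap.coe_inj]
    exact _root_.mul_eq_one_comm.1 h
  · refine ContinuousLinearMap.ext fun x => ?_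
    have := L.extend_apply (W.equivRange x)
    simpa [L] using! this

/-- An operator commuting with `1 ⊗ L(B)` is of the form `L ⊗ 1`. -/
theorem exists_mapL_one_of_commute [Nontrivial B] (T : A ⊗[ℂ] B →L[ℂ] A ⊗[ℂ] B)
    (hT : ∀ τ : B →L[ℂ] B, T ∘L TensorProduct.mapL 1 τ = TensorProduct.mapL 1 τ ∘L T) :
    ∃ L : A →L[ℂ] A, T = TensorProduct.mapL L 1 := by
  obtain ⟨e, he⟩ := exists_norm_eq B zero_le_one
  -- The slice map id ⊗ ⟨e, ·⟩. As a ⊗ b = (1 ⊗ |b⟩⟨e|)(a ⊗ e), commutation gives T(a ⊗ b) = c(T(a ⊗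
  -- e)) ⊗ b, so L a = c(T(a ⊗ e)).
  let c : A ⊗[ℂ] B →ₗ[ℂ] A :=
    (TensorProduct.rid ℂ A).toLinearMap ∘ₗ TensorProduct.map LinearMap.id (innerSL ℂ e).toLinearMap
  have hce : ∀ a : A, c (a ⊗ₜ[ℂ] e) = a := fun a => by
    simp only [c, LinearMap.comp_apply, TensorProduct.map_tmul]
    simp [he]
  have hc : ∀ (b : B) (x : A ⊗[ℂ] B),
      TensorProduct.mapL (1 : A →L[ℂ] A) (rankOne ℂ b e) x = c x ⊗ₜ[ℂ] b := by
    intro b x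
    induction x with
    | zero => simp
    | add x y hx hy => rw [map_add, map_add, hx, hy, TensorProduct.add_tmul]
    | tmul a b' => simp [c, TensorProduct.smul_tmul']
  let L : A →ₗ[ℂ] A := c ∘ₗ T.toLinearMap ∘ₗ (TensorProduct.mk ℂ A B).flip e
  refine ⟨LinearMap.toContinuousLinearMap L, ?_⟩
  rw [← ContinuousLinearMap.coe_inj]
  refine TensorProduct.ext' fun a b => ?_
  have := congrArg (fun S => S (a ⊗ₜ[ℂ] e)) (hT (rankOne ℂ b e))
  simp only [ContinuousLinearMap.comp_apply, hc, hce] at this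
  simpa [L] using this

/-- An orthogonal projection of trace `dim A` is the range projection of an isometry from `A`. -/
theorem exists_isometry_of_projection (Q : H →L[ℂ] H) (hQ : Q * Q = Q)
    (htr : tr Q = Module.finrank ℂ A) : ∃ S : A →ₗᵢ[ℂ] H, ∀ a, Q (S a) = S a := by
  have hproj : LinearMap.IsProj (LinearMap.range Q.toLinearMap) Q.toLinearMap :=
    ⟨fun x => ⟨x, rfl⟩, by
      rintro _ ⟨y, rfl⟩
      exact congrArg (fun T => T y) hQ⟩
  have hdim : Module.finrank ℂ A = Module.finrank ℂ (LinearMap.range Q.toLinearMap) := by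
    have h := hproj.trace
    have h' : tr Q = _ := h
    rw [htr] at h'
    exact_mod_cast h'
  let e := (stdOrthonormalBasis ℂ A).equiv
    (stdOrthonormalBasis ℂ (LinearMap.range Q.toLinearMap)) (finCongr hdim)
  exact ⟨(LinearMap.range Q.toLinearMap).subtypeₗᵢ.comp e.toLinearIsometry,
    fun a => hproj.map_id _ (e a).2⟩

/-- A `*`-representation of `L(B)` of multiplicity `dim A` is unitarily equivalent to
`τ ↦ 1 ⊗ τ` on `A ⊗ B`. -/
theorem exists_isometry_intertwining [Nontrivial B] (π : (B →L[ℂ] B) →ₗ[ℂ] (H →L[ℂ] H))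
    (hmul : ∀ σ τ, π (σ * τ) = π σ * π τ) (hadj : ∀ τ, π τ.adjoint = (π τ).adjoint)
    (htr : ∀ τ, tr (π τ) = Module.finrank ℂ A * tr τ) :
    ∃ W : A ⊗[ℂ] B →ₗᵢ[ℂ] H,
      (∀ τ, W.toContinuousLinearMap ∘L TensorProduct.mapL 1 τ =
        π τ ∘L W.toContinuousLinearMap) ∧
      W.toContinuousLinearMap ∘L W.toContinuousLinearMap.adjoint = π 1 := by
  obtain ⟨e, he⟩ := exists_norm_eq B zero_le_one
  have hQ : π (rankOne ℂ e e) * π (rankOne ℂ e e) = π (rankOne ℂ e e) := by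
    rw [← hmul, isIdempotentElem_rankOne_self he]
  -- The range of π(|e⟩⟨e|) is the multiplicity space. Its dimension is the trace, dim A, so S
  -- identifies it with `A`; the images π(|b⟩⟨e|) then move this copy around.
  obtain ⟨S, hS⟩ := exists_isometry_of_projection (A := A) (π (rankOne ℂ e e)) hQ (by
    rw [htr, ← one_mul (rankOne ℂ e e), tr_mul_rankOne]
    simp [he])
  let w : A ⊗[ℂ] B →ₗ[ℂ] H := TensorProduct.lift (LinearMap.mk₂ ℂ
    (fun a b => π (rankOne ℂ b e) (S a)) (by simp) (by simp) (by simp) (by simp))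
  have hw : ∀ a b, w (a ⊗ₜ b) = π (rankOne ℂ b e) (S a) := fun _ _ => rfl
  have hin : ∀ x y, inner ℂ (w x) (w y) = inner ℂ x y := by
    intro x y
    induction x with
    | zero => simp
    | add x x' hx hx' => rw [map_add, inner_add_left, inner_add_left, hx, hx']
    | tmul a b =>
      induction y with
      | zero => simp
      | add y y' hy hy' => rw [map_add, inner_add_right, inner_add_right, hy, hy']
      | tmul a' b' =>
        rw [hw, hw, ← adjoint_inner_right, ← hadj, adjoint_rankOne]
        have : π (rankOne ℂ e b) (π (rankOne ℂ b' e) (S a')) = inner ℂ b b' • S a' := by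
          rw [← mul_apply_eq_comp, ← hmul, mul_def, rankOne_comp_rankOne, map_smul,
            _root_.smul_apply, hS]
        rw [this, inner_smul_right, S.inner_map_map, TensorProduct.inner_tmul, mul_comm]
  let W : A ⊗[ℂ] B →ₗᵢ[ℂ] H := w.isometryOfInner hin
  have hint : ∀ τ, W.toContinuousLinearMap ∘L TensorProduct.mapL 1 τ =
      π τ ∘L W.toContinuousLinearMap := by
    intro τ
    rw [← ContinuousLinearMap.coe_inj]
    refine TensorProduct.ext' fun a b => ?_
    change w (a ⊗ₜ τ b) = π τ (w (a ⊗ₜ b))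
    rw [hw, hw, ← mul_apply_eq_comp, ← hmul, mul_def, comp_rankOne]
  refine ⟨W, hint, ?_⟩
  have hWW := adjoint_comp_isometry W
  set v := W.toContinuousLinearMap with hv
  have h1 : π 1 ∘L v = v := by
    rw [← hint, mapL_one_one, one_def, comp_id]
  have hadj1 : (π 1).adjoint = π 1 := by rw [← hadj, adjoint_one]
  have h1' : v.adjoint ∘L π 1 = v.adjoint := by
    rw [← hadj1, ← adjoint_comp, h1]
  -- The range of W lies in that of π(1), so the difference is a projection. Its trace is dim A ·
  -- dim B - dim(A ⊗ B) = 0.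
  have hself : (π 1 - v ∘L v.adjoint) ∘L (π 1 - v ∘L v.adjoint).adjoint =
      π 1 - v ∘L v.adjoint := by
    have e1 : π 1 ∘L π 1 = π 1 := by rw [← mul_def, ← hmul, one_mul]
    simp only [map_sub, hadj1, adjoint_comp, adjoint_adjoint, sub_comp, comp_sub, e1]
    rw [comp_assoc v, h1', ← comp_assoc (π 1), h1, comp_assoc v, ← comp_assoc v.adjoint v, hWW]
    exact sub_eq_self.2 (sub_self _)
  have hz := eq_zero_of_tr_sum_comp_adjoint (fun _ : Unit => π 1 - v ∘L v.adjoint) (by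
    simp only [Finset.univ_unique, Finset.sum_singleton]
    rw [hself, map_sub, tr_comp_comm, hWW, htr, tr_one, tr_one, Module.finrank_tensorProduct]
    push_cast
    ring) ()
  exact (sub_eq_zero.1 hz).symm

/-- The operation `τ ↦ E (1 ⊗ τ)` from `L(B)` to `L(H)`. -/
def restrictRight (V : A ⊗[ℂ] B →ₗᵢ[ℂ] H) (E : Superop H H) : Superop B H :=
  E ∘ₗ conj V.toContinuousLinearMap ∘ₗ (opTensorEquiv A B).toLinearMap ∘ₗ
    TensorProduct.mk ℂ (A →L[ℂ] A) (B →L[ℂ] B) 1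

theorem restrictRight_apply (V : A ⊗[ℂ] B →ₗᵢ[ℂ] H) (E : Superop H H) (τ : B →L[ℂ] B) :
    restrictRight V E τ = E (V.toContinuousLinearMap ∘L TensorProduct.mapL 1 τ ∘L
      V.toContinuousLinearMap.adjoint) := by
  simp [restrictRight, conj_apply, opTensorEquiv_tmul]

/-! ### Noiseless implies unitarily correctable. -/

theorem IsNoiseless.isUnitarilyCorrectable (V : A ⊗[ℂ] B →ₗᵢ[ℂ] H) {E : Superop H H}
    (hE : IsChannel E) (hE1 : IsUnital E) (hV : IsNoiseless V (dual E ∘ₗ E)) :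
    IsUnitarilyCorrectable V E := by
  rcases subsingleton_or_nontrivial B with _ | _
  · exact isUnitarilyCorrectable_of_subsingleton V _
  obtain ⟨G, hG, h⟩ := hV
  have htr := hE.trace_preserving
  obtain ⟨ι, _, K, rfl, hK⟩ := hE.exists_kraus
  have hK1 : kraus K 1 = 1 := hE1
  rw [comp_compressAB_eq_extendAB_iff] at h
  have hdual : dual (kraus K) ∘ₗ kraus K =
      kraus fun p : ι × ι => (K p.1).adjoint ∘L K p.2 := by
    rw [dual_kraus, kraus_comp_kraus]
  -- E† ∘ E has Kraus operators K_i† K_j and is unital: E fixes 1 by hypothesis, E† because E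
  -- preserves the trace.
  have hG1 : G 1 = 1 := by
    rw [hdual] at h
    refine (unital_and_reduced_of_kraus V _ ?_ G hG.trace_preserving h).1
    rw [← hdual, LinearMap.comp_apply, hK1, dual_kraus, kraus_apply]
    simp only [adjoint_adjoint, clm_one_comp, hK]
  have hvv := adjoint_comp_isometry V
  set π := restrictRight V (kraus K) with hπ
  have hπ_apply := restrictRight_apply V (kraus K)
  rw [← hπ] at hπ_apply
  set v := V.toContinuousLinearMap with hv
  let X : (B →L[ℂ] B) → (H →L[ℂ] H) := fun τ => v ∘L TensorProduct.mapL 1 τ ∘L v.adjoint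
  have hπX : ∀ τ, π τ = kraus K (X τ) := hπ_apply
  have hX : ∀ τ i, K i ∘L X τ = π τ ∘L K i := by
    intro τ i
    rw [hπX]
    refine comp_eq_of_dual_comp_fixed K hK1 htr _ ?_ i
    rw [← LinearMap.comp_apply, h, superTensor_mapL, hG1, LinearMap.id_apply]
  have hXmul : ∀ σ τ, X (σ * τ) = X σ * X τ := by
    intro σ τ
    simp only [X, mul_def, comp_assoc]
    rw [← comp_assoc v.adjoint v, hvv, clm_one_comp, ← comp_assoc (TensorProduct.mapL _ σ),
      ← TensorProduct.mapL_comp, clm_one_comp]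
  have hXadj : ∀ τ, X τ.adjoint = (X τ).adjoint := by
    intro τ
    simp only [X, adjoint_comp, adjoint_adjoint, TensorProduct.adjoint_mapL, adjoint_one,
      comp_assoc]
  have hmul : ∀ σ τ, π (σ * τ) = π σ * π τ := by
    intro σ τ
    rw [hπX τ, hπX, hXmul, kraus_apply, kraus_apply, Finset.mul_sum]
    refine Finset.sum_congr rfl fun i _ => ?_
    rw [mul_def, mul_def, comp_assoc, ← comp_assoc (K i), hX, comp_assoc]
  have hadj : ∀ τ, π τ.adjoint = (π τ).adjoint := by
    intro τ
    rw [hπX, hπX, adjoint_kraus, hXadj]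
  have hπtr : ∀ τ, tr (π τ) = Module.finrank ℂ A * tr τ := by
    intro τ
    rw [hπX, htr, tr_comp_comm, comp_assoc, hvv, clm_comp_one, tr_mapL, tr_one]
  obtain ⟨W, hW, hWW⟩ := exists_isometry_intertwining (A := A) π hmul hadj hπtr
  obtain ⟨U, hU, hUW⟩ := exists_unitary_comp_eq V W
  rw [← hv] at hUW
  set w := W.toContinuousLinearMap with hw
  have hW' : ∀ τ, w.adjoint ∘L π τ = TensorProduct.mapL 1 τ ∘L w.adjoint := by
    intro τ
    have := congrArg adjoint (hW τ.adjoint)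
    rw [adjoint_comp, adjoint_comp, TensorProduct.adjoint_mapL, adjoint_one, adjoint_adjoint, hadj,
      adjoint_adjoint] at this
    exact this.symm
  have hXv : ∀ τ, X τ ∘L v = v ∘L TensorProduct.mapL 1 τ := by
    intro τ
    simp only [X, comp_assoc]
    rw [hvv, clm_comp_one]
  have hex : ∀ i, ∃ L : A →L[ℂ] A, w.adjoint ∘L K i ∘L v = TensorProduct.mapL L 1 := by
    intro i
    refine exists_mapL_one_of_commute _ fun τ => ?_
    rw [comp_assoc, comp_assoc, ← hXv, ← comp_assoc (K i), hX, comp_assoc, ← comp_assoc w.adjoint,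
      hW', comp_assoc]
  choose L hL using hex
  -- K_i maps the block into the range of W, because K_i V = K_i X_1 V = π(1) K_i V and π(1) = W W†.
  have hKv : ∀ i, K i ∘L v = w ∘L TensorProduct.mapL (L i) 1 := by
    intro i
    rw [← hL, ← comp_assoc w, hWW, ← comp_assoc, ← hX, comp_assoc, hXv, mapL_one_one, clm_comp_one]
  have hUKv : ∀ i, U ∘L K i ∘L v = v ∘L TensorProduct.mapL (L i) 1 := by
    intro i
    rw [hKv, ← comp_assoc, hUW]
  refine ⟨U, hU, kraus L, isChannel_kraus ?_, ?_⟩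
  -- Trace preservation passes from the K_i to the L_i: (∑ L_i† L_i) ⊗ 1 = V† (∑ K_i† K_i) V = 1.
  · refine mapL_one_right_injective (B := B) ?_
    have hww : w.adjoint ∘L w = 1 := adjoint_comp_isometry W
    have hterm : ∀ i, TensorProduct.mapL ((L i).adjoint ∘L L i) (1 : B →L[ℂ] B) =
        v.adjoint ∘L ((K i).adjoint ∘L K i) ∘L v := by
      intro i
      have h1 : v.adjoint ∘L ((K i).adjoint ∘L K i) ∘L v = (K i ∘L v).adjoint ∘L (K i ∘L v) := by
        simp only [adjoint_comp, comp_assoc]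
      rw [h1, hKv, adjoint_comp, comp_assoc, ← comp_assoc w.adjoint, hww, clm_one_comp,
        TensorProduct.adjoint_mapL, ← TensorProduct.mapL_comp, adjoint_one, clm_one_comp]
    have hsum : TensorProduct.mapL (∑ i, (L i).adjoint ∘L L i) (1 : B →L[ℂ] B) =
        ∑ i, TensorProduct.mapL ((L i).adjoint ∘L L i) (1 : B →L[ℂ] B) := by
      simp only [← opTensorEquiv_tmul, TensorProduct.sum_tmul, map_sum]
    rw [hsum, Finset.sum_congr rfl fun i _ => hterm i, ← comp_finsetSum, ← finsetSum_comp, hK,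
      mapL_one_one, clm_one_comp, hvv]
  · rw [← LinearMap.comp_assoc, comp_compressAB_eq_extendAB_iff]
    intro ρ
    rw [← hv, superTensor_kraus_id, LinearMap.comp_apply, kraus_apply, kraus_apply, conj_apply]
    simp only [finsetSum_comp, comp_finsetSum]
    refine Finset.sum_congr rfl fun i _ => ?_
    have h1 := hUKv i
    have h2 := congrArg adjoint h1
    simp only [adjoint_comp, comp_assoc] at h2
    simp only [comp_assoc]
    rw [h2, ← comp_assoc (K i), ← comp_assoc U, h1]
    simp only [comp_assoc]

end Representation

end QSub

end

theorem theorem2 {A B H : Type*}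
    [NormedAddCommGroup A] [InnerProductSpace ℂ A] [FiniteDimensional ℂ A] [CompleteSpace A]
    [NormedAddCommGroup B] [InnerProductSpace ℂ B] [FiniteDimensional ℂ B] [CompleteSpace B]
    [NormedAddCommGroup H] [InnerProductSpace ℂ H] [FiniteDimensional ℂ H] [CompleteSpace H]
    (V : A ⊗[ℂ] B →ₗᵢ[ℂ] H)
    (E : QSub.Superop H H) (hE : QSub.IsChannel E) (hE1 : QSub.IsUnital E) :
    QSub.IsUnitarilyCorrectable V E ↔ QSub.IsNoiseless V (QSub.dual E ∘ₗ E) := by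
  exact ⟨fun h => h.isNoiseless_dual_comp V hE hE1, fun h => h.isUnitarilyCorrectable V hE hE1⟩
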